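/- All graphs are finite, undirected, without loops or multiple edges, and $\mathrm{dist}_G(u,v)$ denotes the usual graph distance ($\infty$ between different connected components). A subgraph $H$ of $G$ is \emph{isometric} if $\mathrm{dist}_H(u,v)=\mathrm{dist}_G(u,v)$ for all vertices $u,v$ of $H$. A graph $U$ is \emph{isometric-universal} for a family $\mathcal F$ of graphs if every member of $\mathcal F$ is isomorphic to an isometric subgraph of $U$. It is \emph{minimum} if it has the smallest number of vertices among all isometric-universal graphs for $\mathcal F$, and \emph{minimal} if no proper subgraph of $U$ is isometric-universal for $\mathcal F$. A \emph{minimum isometric-universal tree} for $\mathcal F$ is a tree that is isometric-universal for $\mathcal F$ and has the smallest number of vertices among all such trees. Let $\mathsf A$ be any algorithm (black box) that, for every pair of graphs $G,H$, returns an isometric-universal graph $\mathsf A(G,H)$ for $\{G,H\}$ that is both minimum and minimal. For graphs taken in an order $G_1,\dots,G_n$ ($n\ge 1$), the greedy strategy based on $\mathsf A$ builds $U_1=G_1$ and $U_i=\mathsf A(U_{i-1},G_i)$ for $1<i\le n$, and returns $U_n$. \textbf{Proposition.} (1) There is a finite non-empty family $\mathcal F$ of pairwise non-isomorphic trees such that,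 for every ordering of $\mathcal F$, the graph returned by the greedy strategy based on $\mathsf A$ is not a minimum isometric-universal graph for $\mathcal F$. (2) There is a finite non-empty family $\mathcal F$ of pairwise non-isomorphic trees such that, for every ordering of $\mathcal F$, the graph returned by the greedy strategy based on $\mathsf A$ is not a minimum isometric-universal tree for $\mathcal F$. In particular, whatever rule is used to choose the order, no greedy strategy based on $\mathsf A$ computes a minimum isometric-universal graph, or a minimum isometric-universal tree, for all families of trees. -/

import Mathlib

namespace IsoUniv

/-- A finite undirected graph, without loops or multiple edges. -/
structure FinGraph where
  V : Type
  finite : Finite V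
  graph : SimpleGraph V

attribute [instance] FinGraph.finite

namespace FinGraph

/-- The number of vertices. -/
noncomputable def order (G : FinGraph) : ℕ := Nat.card G.V

/-- Being a (nonempty) tree: connected and acyclic. -/
def IsTree (G : FinGraph) : Prop := G.graph.IsTree

/-- Two graphs are isomorphic. -/
def Isomorphic (G H : FinGraph) : Prop := Nonempty (G.graph ≃g H.graph)

/-- A subgraph (any subset of the vertices with any subset of the edges between them),
seen as a graph of its own. -/
def ofSubgraph (U : FinGraph) (H : U.graph.Subgraph) : FinGraph where
  V := H.verts
  finite := inferInstance
  graph := H.coe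

end FinGraph

/-- A subgraph `H` of `U` is isometric if distances between vertices of `H`, measured in `H`, are
the same as in `U`. The distance `edist` is `⊤` between different connected components. -/
def IsIsometricSubgraph (U : FinGraph) (H : U.graph.Subgraph) : Prop :=
  ∀ u v : H.verts, H.coe.edist u v = U.graph.edist u v

/-- `U` is an isometric-universal graph for the family `F`: every member of the family is isomorphic
to an isometric subgraph of `U`. -/
def IsIsometricUniversal {ι : Type} (F : ι → FinGraph) (U : FinGraph) : Prop :=
  ∀ i, ∃ H : U.graph.Subgraph, IsIsometricSubgraph U H ∧ (F i).Isomorphic (U.ofSubgraph H)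

/-- `U` is a minimum isometric-universal graph for `F`: it has the smallest possible number of
vertices. -/
def IsMinimumIsometricUniversal {ι : Type} (F : ι → FinGraph) (U : FinGraph) : Prop :=
  IsIsometricUniversal F U ∧ ∀ W : FinGraph, IsIsometricUniversal F W → U.order ≤ W.order

/-- `U` is a minimal isometric-universal graph for `F`: no proper subgraph of `U` is
isometric-universal for `F`. -/
def IsMinimalIsometricUniversal {ι : Type} (F : ι → FinGraph) (U : FinGraph) : Prop :=
  IsIsometricUniversal F U ∧
    ∀ H : U.graph.Subgraph, H ≠ ⊤ → ¬ IsIsometricUniversal F (U.ofSubgraph H)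

/-- `U` is a minimum isometric-universal tree for `F`: it has the smallest number of vertices among
the isometric-universal graphs for `F` that are trees. -/
def IsMinimumIsometricUniversalTree {ι : Type} (F : ι → FinGraph) (U : FinGraph) : Prop :=
  U.IsTree ∧ IsIsometricUniversal F U ∧
    ∀ W : FinGraph, W.IsTree → IsIsometricUniversal F W → U.order ≤ W.order

/-- The black box `A` returns, for every pair of graphs, an isometric-universal graph for this pair
that is both minimum and minimal. -/
def IsMinimumMinimalPairOracle (A : FinGraph → FinGraph → FinGraph) : Prop :=
  ∀ G H : FinGraph, IsMinimumIsometricUniversal ![G, H] (A G H) ∧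
    IsMinimalIsometricUniversal ![G, H] (A G H)

/-- The sequence built by the greedy strategy with black box `A` on the graphs taken in the order
`G 0, …, G m`: the first term is `G 0`, and the term with index `i + 1` is `A` applied to the term
with index `i` and the graph `G (i + 1)`. -/
def greedySeq (A : FinGraph → FinGraph → FinGraph) {m : ℕ} (G : Fin (m + 1) → FinGraph) :
    Fin (m + 1) → FinGraph :=
  Fin.induction (G 0) (fun i U => A U (G i.succ))

/-- The graph returned by the greedy strategy: the last term of its sequence. -/
def greedyResult (A : FinGraph → FinGraph → FinGraph) {m : ℕ} (G : Fin (m + 1) → FinGraph) :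
    FinGraph :=
  greedySeq A G (Fin.last m)

/-- A family of trees: all members are trees, and no two of them are isomorphic. -/
def IsTreeFamily {ι : Type} (F : ι → FinGraph) : Prop :=
  (∀ i, (F i).IsTree) ∧ Pairwise fun i j => ¬ (F i).Isomorphic (F j)

end IsoUniv

/-!
The same family of three trees serves for both claims. A double broom is a path with `s` leaves at
each of its two ends, where `s` exceeds all path lengths in sight. The family consists of the three
double brooms whose paths have lengths `a + b`, `a + c` and `b + c`, with `(a, b, c) = (10, 20, 30)`
and `s = 100`. The spider with legs of lengths `a`, `b`, `c` and with `s` leaves at each foot is a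
tree that contains them all isometrically. It has `3 * s + a + b + c + 1` vertices
(`isIsometricUniversal_spider`, `spiderGraph_order`), fewer than `4 * s`.

In any order, the first step of the greedy strategy takes two of the double brooms, with paths of
lengths `d₁ ≤ d₂` say. They fit into a graph with `3 * s + d₂ + 1` vertices: attach `s` leaves to a
vertex of the longer path (`exists_pair_universal`). A graph that is minimum for the pair is no
larger, so in it the two brooms share at least `s + d₁ + 1` vertices. Since `s` is large they share a
leaf (`exists_common_leaf`), and by counting they also share a vertex far away from it
(`exists_common_far`). Thus, starting from a common end, the two paths run close to each other until
the shorter one stops, and the two other ends are at distance about `d₂ - d₁`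
(`edist_ne_of_overlap`). All this persists in the final graph, which contains the first one
isometrically. But the ends of the third broom are at a distance `d₃` which differs clearly from `0`,
`d₁`, `d₂` and `d₂ - d₁`, so the leaves at one of its ends are all new, and the final graph has at
least `4 * s` vertices (`four_mul_le_card`).

Only the distances between vertices of the brooms are used, and only approximately; nothing has to be
known about the structure of the graphs which the black box returns.
-/

namespace IsoUniv

open SimpleGraph

/-! ### Isometric embeddings -/

/-- `G` embeds isometrically into `U`: some map preserves all distances. Such a map is automatically
injective and preserves adjacency in both directions. -/
def IsoEmbeds (G U : FinGraph) : Prop :=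
  ∃ f : G.V → U.V, ∀ u v, U.graph.edist (f u) (f v) = G.graph.edist u v

lemma edist_map_le {V W : Type*} {G : SimpleGraph V} {H : SimpleGraph W} (f : G →g H) (u v : V) :
    H.edist (f u) (f v) ≤ G.edist u v := by
  by_cases h : G.edist u v = ⊤
  · simp [h]
  · obtain ⟨p, hp⟩ := exists_walk_of_edist_ne_top h
    rw [← hp, ← Walk.length_map f p]
    exact edist_le _

lemma edist_iso {V W : Type*} {G : SimpleGraph V} {H : SimpleGraph W} (f : G ≃g H) (u v : V) :
    H.edist (f u) (f v) = G.edist u v := by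
  refine le_antisymm (edist_map_le f.toHom u v) ?_
  simpa using edist_map_le f.symm.toHom (f u) (f v)

lemma injective_of_edist {V W : Type*} {G : SimpleGraph V} {H : SimpleGraph W} {f : V → W}
    (hf : ∀ u v, H.edist (f u) (f v) = G.edist u v) : Function.Injective f := by
  intro u v h
  have := hf u v
  rw [h, edist_self] at this
  exact edist_eq_zero_iff.1 this.symm

lemma isIsometricUniversal_iff {ι : Type} {F : ι → FinGraph} {U : FinGraph} :
    IsIsometricUniversal F U ↔ ∀ i, IsoEmbeds (F i) U := by
  refine forall_congr' fun i => ⟨?_, ?_⟩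
  · rintro ⟨H, hH, ⟨e⟩⟩
    refine ⟨fun v => (e v : H.verts).1, fun u v => ?_⟩
    rw [← edist_iso e u v]
    exact (hH (e u) (e v)).symm
  · rintro ⟨f, hf⟩
    have adj : ∀ {u v}, (F i).graph.Adj u v → U.graph.Adj (f u) (f v) := by
      intro u v h
      rwa [← edist_eq_one_iff_adj, hf, edist_eq_one_iff_adj]
    let c : Copy (F i).graph U.graph := ⟨⟨f, adj⟩, injective_of_edist hf⟩
    have hval : ∀ v, (c.isoToSubgraph v).1 = f v := fun v => rfl
    refine ⟨c.toSubgraph, fun x y => ?_, ⟨c.isoToSubgraph⟩⟩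
    obtain ⟨u, rfl⟩ := c.isoToSubgraph.surjective x
    obtain ⟨v, rfl⟩ := c.isoToSubgraph.surjective y
    rw [edist_iso c.isoToSubgraph u v, hval, hval, hf]

/-- An injective homomorphism from a connected graph into an acyclic graph is isometric, since it
maps each path to the only path between the images of its ends. -/
lemma edist_of_injective_hom {V W : Type*} {G : SimpleGraph V} {H : SimpleGraph W}
    (hG : G.Connected) (hH : H.IsAcyclic) (f : G →g H) (hf : Function.Injective f) (u v : V) :
    H.edist (f u) (f v) = G.edist u v := by
  obtain ⟨p, hp, hpl⟩ := hG.exists_path_of_dist u v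
  have hpm : (p.map f).IsPath := hp.map hf
  obtain ⟨q, hq, hql⟩ := Reachable.exists_path_of_dist (p.map f).reachable
  have hpq : p.map f = q :=
    congrArg Subtype.val ((hH.subsingleton_path _ _).elim ⟨_, hpm⟩ ⟨_, hq⟩)
  rw [← (p.map f).reachable.coe_dist_eq_edist, ← p.reachable.coe_dist_eq_edist, ← hql, ← hpl, ← hpq,
    Walk.length_map]

/-- A finite graph whose edges join each vertex other than the root `r` to a parent of smaller
height is a tree. -/
lemma isTree_of_parent {V : Type*} [Finite V] {G : SimpleGraph V} (r : V) (par : V → V) (h : V → ℕ)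
    (hpar : ∀ v, v ≠ r → G.Adj v (par v) ∧ h (par v) < h v)
    (hadj : ∀ u v, G.Adj u v → (u ≠ r ∧ par u = v) ∨ (v ≠ r ∧ par v = u)) : G.IsTree := by
  have reach : ∀ n v, h v = n → G.Reachable v r := by
    intro n
    induction n using Nat.strong_induction_on with
    | _ n ih =>
      intro v hv
      by_cases hvr : v = r
      · rw [hvr]
      · obtain ⟨ha, hl⟩ := hpar v hvr
        exact ha.reachable.trans (ih _ (hv ▸ hl) _ rfl)
  have : Nonempty V := ⟨r⟩
  have hconn : G.Connected := ⟨fun u v => (reach _ u rfl).trans (reach _ v rfl).symm⟩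
  refine isTree_iff_connected_and_card.2
    ⟨hconn, le_antisymm ?_ hconn.card_vert_le_card_edgeSet_add_one⟩
  let g : {v // v ≠ r} → G.edgeSet := fun v => ⟨s(v.1, par v.1), (hpar v.1 v.2).1⟩
  have hg : Function.Surjective g := by
    rintro ⟨e, he⟩
    induction e using Sym2.ind with
    | _ u v =>
      rcases hadj u v he with ⟨hu, rfl⟩ | ⟨hv, rfl⟩
      · exact ⟨⟨u, hu⟩, rfl⟩
      · exact ⟨⟨v, hv⟩, Subtype.ext Sym2.eq_swap⟩
  have h1 := Nat.card_le_card_of_surjective g hg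
  have h2 : Nat.card {v // v ≠ r} + 1 = Nat.card V := by
    have := Set.ncard_add_ncard_compl ({r} : Set V)
    rw [Set.ncard_singleton] at this
    have h3 : Nat.card {v // v ≠ r} = ({r}ᶜ : Set V).ncard := rfl
    omega
  omega

/-! ### Double brooms -/

/-- The vertices of a double broom: a path with `d + 1` vertices and `s` leaves at either end. -/
abbrev BroomV (s d : ℕ) : Type := Fin (d + 1) ⊕ Bool × Fin s

/-- The level of a vertex of a double broom: `0` for the leaves at the first end, then `1`, …,
`d + 1` along the path, and `d + 2` for the leaves at the other end. -/
def pos {s d : ℕ} : BroomV s d → ℕ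
  | Sum.inl i => i + 1
  | Sum.inr (false, _) => 0
  | Sum.inr (true, _) => d + 2

/-- The double broom: two vertices are adjacent when their levels are consecutive. As only the
extreme levels have more than one vertex, each leaf is adjacent to one end of the path only. -/
def broom (s d : ℕ) : SimpleGraph (BroomV s d) where
  Adj u v := pos u + 1 = pos v ∨ pos v + 1 = pos u
  symm := ⟨fun _ _ h => h.symm⟩
  loopless := ⟨fun _ h => by omega⟩

/-- The double broom as a `FinGraph`. -/
def broomGraph (s d : ℕ) : FinGraph := ⟨BroomV s d, inferInstance, broom s d⟩

lemma broomGraph_order (s d : ℕ) : (broomGraph s d).order = d + 1 + 2 * s := by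
  simp [FinGraph.order, broomGraph, Nat.card_eq_fintype_card]

lemma pos_le {s d : ℕ} (u : BroomV s d) : pos u ≤ d + 2 := by
  rcases u with i | ⟨_ | _, t⟩ <;> simp only [pos] <;> omega

lemma edist_broom_le_of_lt {s d : ℕ} (n : ℕ) : ∀ u v : BroomV s d, pos v = pos u + (n + 1) →
    (broom s d).edist u v ≤ (n + 1 : ℕ) := by
  induction n with
  | zero =>
    intro u v h
    have : (broom s d).Adj u v := Or.inl h.symm
    simp [edist_eq_one_iff_adj.2 this]
  | succ n ih =>
    intro u v h
    have hv := pos_le v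
    let w : BroomV s d := Sum.inl ⟨pos u + n, by omega⟩
    have hw : pos w = pos u + (n + 1) := rfl
    have hwv : (broom s d).Adj w v := Or.inl (by omega)
    calc (broom s d).edist u v ≤ (broom s d).edist u w + (broom s d).edist w v :=
          SimpleGraph.edist_triangle
      _ ≤ (n + 1 : ℕ) + 1 := add_le_add (ih u w hw) (edist_eq_one_iff_adj.2 hwv).le
      _ = (n + 1 + 1 : ℕ) := by push_cast; rfl

lemma edist_broom_le_two {s d : ℕ} {u v : BroomV s d} (h : pos u = pos v) :
    (broom s d).edist u v ≤ 2 := by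
  obtain rfl | huv := eq_or_ne u v
  · simp
  obtain ⟨w, hw⟩ : ∃ w : BroomV s d, pos u + 1 = pos w ∨ pos w + 1 = pos u := by
    rcases u with i | ⟨_ | _, t⟩
    · refine absurd ?_ huv
      rcases v with i' | ⟨_ | _, t'⟩ <;> simp only [pos] at h
      · exact congrArg Sum.inl (Fin.ext (by omega))
      all_goals omega
    · exact ⟨Sum.inl ⟨0, by omega⟩, Or.inl rfl⟩
    · exact ⟨Sum.inl ⟨d, by omega⟩, Or.inr rfl⟩
  have huw : (broom s d).Adj u w := hw
  have hwv : (broom s d).Adj w v := by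
    change pos w + 1 = pos v ∨ pos v + 1 = pos w
    omega
  calc (broom s d).edist u v ≤ (broom s d).edist u w + (broom s d).edist w v :=
        SimpleGraph.edist_triangle
    _ = 2 := by
        rw [edist_eq_one_iff_adj.2 huw, edist_eq_one_iff_adj.2 hwv]; rfl

/-- In a double broom, distances agree with differences of levels, up to an excess of `2` which is
due to pairs of leaves at the same end. -/
lemma edist_broom {s d : ℕ} (u v : BroomV s d) : ∃ n : ℕ, (broom s d).edist u v = n ∧
    pos u ≤ pos v + n ∧ pos v ≤ pos u + n ∧ (n ≤ 2 ∨ n + pos u ≤ pos v + 2 ∨ n + pos v ≤ pos u + 2)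
    := by
  have lower : ∀ {u v : BroomV s d} (p : (broom s d).Walk u v),
      pos u ≤ pos v + p.length ∧ pos v ≤ pos u + p.length := by
    intro u v p
    induction p with
    | nil => simp
    | cons h p ih =>
      rw [Walk.length_cons]
      rcases h with h | h <;> omega
  have upper : ∃ k : ℕ, (broom s d).edist u v ≤ k ∧
      (k ≤ 2 ∨ k + pos u ≤ pos v + 2 ∨ k + pos v ≤ pos u + 2) := by
    rcases lt_trichotomy (pos u) (pos v) with h | h | h
    · exact ⟨_, edist_broom_le_of_lt (pos v - pos u - 1) u v (by omega), by omega⟩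
    · exact ⟨2, edist_broom_le_two h, by omega⟩
    · exact ⟨_, SimpleGraph.edist_comm.trans_le
        (edist_broom_le_of_lt (pos u - pos v - 1) v u (by omega)), by omega⟩
  obtain ⟨k, hk, hk'⟩ := upper
  obtain ⟨p, hp⟩ := exists_walk_of_edist_ne_top (ne_top_of_le_ne_top (ENat.natCast_ne_top k) hk)
  have hpk : p.length ≤ k := by
    rw [← hp] at hk
    exact_mod_cast hk
  obtain ⟨h1, h2⟩ := lower p
  exact ⟨p.length, hp.symm, h1, h2, by omega⟩

lemma broom_connected (s d : ℕ) : (broom s d).Connected := by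
  have : Nonempty (BroomV s d) := ⟨Sum.inl 0⟩
  refine ⟨fun u v => ?_⟩
  obtain ⟨n, hn, -⟩ := edist_broom u v
  exact reachable_of_edist_ne_top (by rw [hn]; exact ENat.natCast_ne_top n)

/-- The symmetry of a double broom that exchanges its ends. -/
def flip {s d : ℕ} : BroomV s d ≃ BroomV s d :=
  Equiv.sumCongr Fin.revPerm (Equiv.prodCongr Equiv.boolNot (Equiv.refl _))

lemma pos_flip {s d : ℕ} (u : BroomV s d) : pos (flip u) + pos u = d + 2 := by
  rcases u with i | ⟨_ | _, t⟩ <;> simp [flip, pos]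
  omega

lemma edist_flip {s d : ℕ} (u v : BroomV s d) :
    (broom s d).edist (flip u) (flip v) = (broom s d).edist u v := by
  let e : broom s d ≃g broom s d := ⟨flip, by
    intro u v
    have hu := pos_flip u
    have hv := pos_flip v
    change (pos (flip u) + 1 = pos (flip v) ∨ pos (flip v) + 1 = pos (flip u)) ↔
      (pos u + 1 = pos v ∨ pos v + 1 = pos u)
    omega⟩
  exact edist_iso e u v

/-! ### Spiders with brooms at their feet -/

/-- The vertices of a spider whose three legs have `ℓ 0`, `ℓ 1`, `ℓ 2` edges and carry `s` leaves at
their feet: the center is `none`, and each leg has its path vertices and its leaves. -/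
abbrev SpiderV (s : ℕ) (ℓ : Fin 3 → ℕ) : Type := Option (Σ j : Fin 3, Fin (ℓ j) ⊕ Fin s)

/-- The vertex of leg `j` at distance `n` from the center; the value for `n > ℓ j` is irrelevant. -/
def legVertex {s : ℕ} {ℓ : Fin 3 → ℕ} (j : Fin 3) : ℕ → SpiderV s ℓ
  | 0 => none
  | n + 1 => if h : n < ℓ j then some ⟨j, Sum.inl ⟨n, h⟩⟩ else none

/-- The neighbor of a vertex in the direction of the center. -/
def parent {s : ℕ} {ℓ : Fin 3 → ℕ} : SpiderV s ℓ → SpiderV s ℓ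
  | none => none
  | some ⟨j, Sum.inl i⟩ => legVertex j i
  | some ⟨j, Sum.inr _⟩ => legVertex j (ℓ j)

/-- The distance to the center. -/
def depth {s : ℕ} {ℓ : Fin 3 → ℕ} : SpiderV s ℓ → ℕ
  | none => 0
  | some ⟨_, Sum.inl i⟩ => i + 1
  | some ⟨j, Sum.inr _⟩ => ℓ j + 1

lemma depth_legVertex {s : ℕ} {ℓ : Fin 3 → ℕ} {j : Fin 3} {n : ℕ} (h : n ≤ ℓ j) :
    depth (legVertex j n : SpiderV s ℓ) = n := by
  cases n with
  | zero => rfl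
  | succ n =>
    have h' : n < ℓ j := h
    simp [legVertex, h', depth]

lemma depth_parent {s : ℕ} {ℓ : Fin 3 → ℕ} {v : SpiderV s ℓ} (hv : v ≠ none) :
    depth (parent v) < depth v := by
  rcases v with _ | ⟨j, i | t⟩
  · exact absurd rfl hv
  · exact (depth_legVertex i.2.le).trans_lt (Nat.lt_succ_self _)
  · exact (depth_legVertex le_rfl).trans_lt (Nat.lt_succ_self _)

/-- The spider: each vertex other than the center is adjacent to its parent. -/
def spider (s : ℕ) (ℓ : Fin 3 → ℕ) : SimpleGraph (SpiderV s ℓ) where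
  Adj u v := (u ≠ none ∧ parent u = v) ∨ (v ≠ none ∧ parent v = u)
  symm := ⟨fun _ _ h => h.symm⟩
  loopless := ⟨by
    rintro v (⟨h, h'⟩ | ⟨h, h'⟩) <;>
    · have := depth_parent h
      rw [h'] at this
      exact lt_irrefl _ this⟩

/-- The spider as a `FinGraph`. -/
def spiderGraph (s : ℕ) (ℓ : Fin 3 → ℕ) : FinGraph := ⟨SpiderV s ℓ, inferInstance, spider s ℓ⟩

lemma spiderGraph_order (s : ℕ) (ℓ : Fin 3 → ℕ) :
    (spiderGraph s ℓ).order = 3 * s + 1 + (ℓ 0 + ℓ 1 + ℓ 2) := by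
  simp [FinGraph.order, spiderGraph, Nat.card_eq_fintype_card, Fin.sum_univ_three]
  omega

lemma spider_isTree (s : ℕ) (ℓ : Fin 3 → ℕ) : (spider s ℓ).IsTree :=
  isTree_of_parent none parent depth (fun _ hv => ⟨Or.inl ⟨hv, rfl⟩, depth_parent hv⟩)
    fun _ _ h => h

lemma legVertex_succ {s : ℕ} {ℓ : Fin 3 → ℕ} {j : Fin 3} {n : ℕ} (h : n < ℓ j) :
    (legVertex j (n + 1) : SpiderV s ℓ) = some ⟨j, Sum.inl ⟨n, h⟩⟩ := by
  simp [legVertex, h]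

lemma adj_legVertex {s : ℕ} {ℓ : Fin 3 → ℕ} {j : Fin 3} {n : ℕ} (h : n < ℓ j) :
    (spider s ℓ).Adj (legVertex j (n + 1)) (legVertex j n) := by
  refine Or.inl ?_
  rw [legVertex_succ h]
  exact ⟨by simp, rfl⟩

lemma adj_leaf {s : ℕ} {ℓ : Fin 3 → ℕ} (j : Fin 3) (t : Fin s) {n : ℕ} (hn : n = ℓ j) :
    (spider s ℓ).Adj (some ⟨j, Sum.inr t⟩) (legVertex j n) :=
  Or.inl ⟨by simp, by subst hn; rfl⟩

lemma legVertex_ne_leaf {s : ℕ} {ℓ : Fin 3 → ℕ} {i j : Fin 3} {n : ℕ} {t : Fin s} :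
    (legVertex i n : SpiderV s ℓ) ≠ some ⟨j, Sum.inr t⟩ := by
  cases n with
  | zero => simp [legVertex]
  | succ n =>
    rw [legVertex]
    split_ifs
    · intro h
      injection h with h
      obtain ⟨rfl, h⟩ := Sigma.mk.inj_iff.1 h
      simp at h
    · simp

lemma legVertex_inj {s : ℕ} {ℓ : Fin 3 → ℕ} {i j : Fin 3} {m n : ℕ} (hm : m ≤ ℓ i) (hn : n ≤ ℓ j)
    (h : (legVertex i m : SpiderV s ℓ) = legVertex j n) : m = n ∧ (m = 0 ∨ i = j) := by
  have hmn : m = n := by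
    have := congrArg depth h
    rwa [depth_legVertex hm, depth_legVertex hn] at this
  refine ⟨hmn, ?_⟩
  subst hmn
  cases m with
  | zero => exact Or.inl rfl
  | succ m =>
    rw [legVertex_succ hm, legVertex_succ hn] at h
    injection h with h
    exact Or.inr (Sigma.mk.inj_iff.1 h).1

/-- The map from a double broom onto the legs `j` and `k` of a spider. -/
def broomToSpider {s : ℕ} {ℓ : Fin 3 → ℕ} (j k : Fin 3) : BroomV s (ℓ j + ℓ k) → SpiderV s ℓ
  | Sum.inl i => if (i : ℕ) ≤ ℓ j then legVertex j (ℓ j - i) else legVertex k (i - ℓ j)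
  | Sum.inr (false, t) => some ⟨j, Sum.inr t⟩
  | Sum.inr (true, t) => some ⟨k, Sum.inr t⟩

lemma broomToSpider_adj {s : ℕ} {ℓ : Fin 3 → ℕ} {j k : Fin 3} {u v : BroomV s (ℓ j + ℓ k)}
    (h : pos u + 1 = pos v) :
    (spider s ℓ).Adj (broomToSpider j k u) (broomToSpider j k v) := by
  rcases u with i | ⟨_ | _, t⟩ <;> rcases v with i' | ⟨_ | _, t'⟩ <;>
    simp only [pos, broomToSpider] at h ⊢ <;> try omega
  · by_cases h1 : (i' : ℕ) ≤ ℓ j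
    · rw [if_pos (by omega), if_pos h1, show ℓ j - (i : ℕ) = (ℓ j - i') + 1 by omega]
      exact adj_legVertex (by omega)
    · rw [if_neg h1]
      by_cases h2 : (i : ℕ) ≤ ℓ j
      · rw [if_pos h2, show ℓ j - (i : ℕ) = 0 by omega, show (i' : ℕ) - ℓ j = 0 + 1 by omega]
        exact (adj_legVertex (j := k) (n := 0) (by omega)).symm
      · rw [if_neg h2, show (i' : ℕ) - ℓ j = (i - ℓ j) + 1 by omega]
        exact (adj_legVertex (by omega)).symm
  · by_cases h2 : (i : ℕ) ≤ ℓ j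
    · rw [if_pos h2, show ℓ j - (i : ℕ) = 0 by omega]
      exact (adj_leaf k t' (n := 0) (by omega)).symm
    · rw [if_neg h2]
      exact (adj_leaf k t' (by omega)).symm
  · rw [if_pos (by omega)]
    exact adj_leaf j t (by omega)

lemma broomToSpider_injective {s : ℕ} {ℓ : Fin 3 → ℕ} {j k : Fin 3} (hjk : j ≠ k) :
    Function.Injective (broomToSpider j k : BroomV s (ℓ j + ℓ k) → SpiderV s ℓ) := by
  intro u v h
  rcases u with i | ⟨_ | _, t⟩ <;> rcases v with i' | ⟨_ | _, t'⟩ <;>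
    simp only [broomToSpider] at h
  · congr 1
    apply Fin.ext
    have hi := i.2
    have hi' := i'.2
    split_ifs at h
    · have := legVertex_inj (by omega) (by omega) h
      omega
    · have := legVertex_inj (by omega) (by omega) h
      rcases this with ⟨h1, h2 | h2⟩
      · omega
      · exact absurd h2 hjk
    · have := legVertex_inj (by omega) (by omega) h
      rcases this with ⟨h1, h2 | h2⟩
      · omega
      · exact absurd h2.symm hjk
    · have := legVertex_inj (by omega) (by omega) h
      omega
  · split_ifs at h <;> exact absurd h legVertex_ne_leaf
  · split_ifs at h <;> exact absurd h legVertex_ne_leaf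
  · split_ifs at h <;> exact absurd h.symm legVertex_ne_leaf
  · simp_all
  · simp_all
  · split_ifs at h <;> exact absurd h.symm legVertex_ne_leaf
  · exfalso
    simp at h
    exact hjk h.1.symm
  · simp_all

lemma isoEmbeds_spider (s : ℕ) (ℓ : Fin 3 → ℕ) {j k : Fin 3} (hjk : j ≠ k) {d : ℕ}
    (hd : d = ℓ j + ℓ k) : IsoEmbeds (broomGraph s d) (spiderGraph s ℓ) := by
  subst hd
  refine ⟨broomToSpider j k, edist_of_injective_hom (broom_connected _ _)
    (spider_isTree s ℓ).isAcyclic ⟨broomToSpider j k, ?_⟩ (broomToSpider_injective hjk)⟩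
  rintro u v (h | h)
  · exact broomToSpider_adj h
  · exact (broomToSpider_adj h).symm

lemma broom_isTree (s d : ℕ) : (broom s d).IsTree := by
  let ℓ : Fin 3 → ℕ := ![d, 0, 0]
  obtain ⟨f, hf⟩ := isoEmbeds_spider s ℓ (j := 0) (k := 1) (by decide) (d := d) rfl
  refine ⟨broom_connected s d, (spider_isTree s ℓ).isAcyclic.comap ⟨f, ?_⟩
    (injective_of_edist hf)⟩
  intro u v h
  exact edist_eq_one_iff_adj.1 ((hf u v).trans (edist_eq_one_iff_adj.2 h))

/-! ### Overlaps of double brooms -/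

lemma le_add_of_edist {X : Type*} {G : SimpleGraph X} {x y z : X} {a b c : ℕ}
    (h₁ : G.edist x y = a) (h₂ : G.edist y z = b) (h₃ : G.edist x z = c) : c ≤ a + b := by
  have h := G.edist_triangle (u := x) (v := y) (w := z)
  rw [h₁, h₂, h₃] at h
  exact_mod_cast h

/-- `f` embeds the double broom isometrically into the graph `G`. -/
def IsBroomMap {X : Type} (G : SimpleGraph X) {s d : ℕ} (f : BroomV s d → X) : Prop :=
  ∀ u v, G.edist (f u) (f v) = (broom s d).edist u v

section Overlap

variable {X : Type} {G : SimpleGraph X} {s d₁ d₂ d₃ : ℕ}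
  {f₁ : BroomV s d₁ → X} {f₂ : BroomV s d₂ → X} {f₃ : BroomV s d₃ → X}

lemma IsBroomMap.flip (h : IsBroomMap G f₁) : IsBroomMap G (f₁ ∘ flip) :=
  fun u v => (h _ _).trans (edist_flip u v)

lemma IsBroomMap.exists_edist (h : IsBroomMap G f₁) (u v : BroomV s d₁) :
    ∃ n : ℕ, G.edist (f₁ u) (f₁ v) = n ∧ G.edist (f₁ v) (f₁ u) = n ∧ pos u ≤ pos v + n ∧
      pos v ≤ pos u + n ∧ (n ≤ 2 ∨ n + pos u ≤ pos v + 2 ∨ n + pos v ≤ pos u + 2) := by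
  obtain ⟨n, hn, hn'⟩ := edist_broom u v
  exact ⟨n, (h u v).trans hn, SimpleGraph.edist_comm.trans ((h u v).trans hn), hn'⟩

/-- If two double brooms share a leaf at the first end of both, then they share no leaf of the
second end of the first broom. -/
lemma leaf_ne_of_common_leaf (h₁ : IsBroomMap G f₁) (h₂ : IsBroomMap G f₂)
    (h12 : d₁ + 2 < d₂ ∨ d₂ + 2 < d₁) (hd : 0 < d₁) {t₁ t₂ : Fin s}
    (h0 : f₁ (Sum.inr (false, t₁)) = f₂ (Sum.inr (false, t₂))) (t : Fin s) (p : Bool × Fin s) :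
    f₁ (Sum.inr (true, t)) ≠ f₂ (Sum.inr p) := by
  intro h
  obtain ⟨n, hn, -, hn'⟩ := h₁.exists_edist (Sum.inr (false, t₁)) (Sum.inr (true, t))
  obtain ⟨m, hm, -, hm'⟩ := h₂.exists_edist (Sum.inr (false, t₂)) (Sum.inr p)
  rw [h0, h, hm] at hn
  have : m = n := by exact_mod_cast hn
  rcases p with ⟨_ | _, t'⟩ <;> simp only [pos] at hn' hm' <;> omega

/-- Suppose that two double brooms share a leaf at the first end of both, and also a vertex `x` whose
level is at least the length of the shorter path. Then no leaf of one broom is at the distance from a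
leaf of the other that separates the leaves at opposite ends of a third broom: if either leaf is at
the first end, the common leaf shows that their distance is nearly `0`, `d₁` or `d₂`; for two second
ends, the vertex `x` shows that it is at most about `|d₁ - d₂|`. -/
lemma edist_ne_of_overlap (h₁ : IsBroomMap G f₁) (h₂ : IsBroomMap G f₂)
    (h13 : d₁ + 6 < d₃ ∨ d₃ + 6 < d₁) (h23 : d₂ + 6 < d₃ ∨ d₃ + 6 < d₂)
    (hd₁ : d₁ + 8 < d₂ + d₃) (hd₂ : d₂ + 8 < d₁ + d₃) {t₁ t₂ : Fin s}
    (h0 : f₁ (Sum.inr (false, t₁)) = f₂ (Sum.inr (false, t₂)))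
    {x : BroomV s d₁} {y : BroomV s d₂} (hxy : f₁ x = f₂ y) (hx : min d₁ d₂ ≤ pos x)
    (p q : Bool × Fin s) {n : ℕ} (hn : d₃ + 2 ≤ n) (hn' : n ≤ d₃ + 4) :
    G.edist (f₁ (Sum.inr p)) (f₂ (Sum.inr q)) ≠ n := by
  intro h
  obtain ⟨a, haa, ha, ha'⟩ := h₁.exists_edist (Sum.inr (false, t₁)) (Sum.inr p)
  obtain ⟨b, hb, hb0, hb'⟩ := h₂.exists_edist (Sum.inr (false, t₂)) (Sum.inr q)
  have t1 : n ≤ a + b := le_add_of_edist ha (h0 ▸ hb) h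
  have t2 : b ≤ a + n := le_add_of_edist (h0 ▸ haa) h hb
  have t3 : a ≤ n + b := le_add_of_edist h (h0 ▸ hb0) ha
  obtain ⟨k, hk, -, hk'⟩ := h₁.exists_edist (Sum.inr (false, t₁)) x
  obtain ⟨k₂, hk₂, -, hk₂'⟩ := h₂.exists_edist (Sum.inr (false, t₂)) y
  rw [h0, hxy, hk₂] at hk
  have hkk : k₂ = k := by exact_mod_cast hk
  obtain ⟨u, -, hu, hu'⟩ := h₁.exists_edist x (Sum.inr p)
  obtain ⟨v, hv, -, hv'⟩ := h₂.exists_edist y (Sum.inr q)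
  have t4 : n ≤ u + v := le_add_of_edist hu (hxy ▸ hv) h
  have hx2 := pos_le x
  have hy2 := pos_le y
  generalize pos x = px at *
  generalize pos y = py at *
  rcases p with ⟨_ | _, t⟩ <;> rcases q with ⟨_ | _, t'⟩ <;>
    simp only [pos] at ha' hb' hk' hk₂' hu' hv' <;> omega

lemma edist_leaf_ne (h₁ : IsBroomMap G f₁) (h13 : d₁ + 6 < d₃ ∨ d₃ + 6 < d₁) (h3 : 2 < d₃)
    (p q : Bool × Fin s) {n : ℕ} (hn : d₃ + 2 ≤ n) (hn' : n ≤ d₃ + 4) :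
    G.edist (f₁ (Sum.inr p)) (f₁ (Sum.inr q)) ≠ n := by
  intro h
  obtain ⟨a, ha, -, ha'⟩ := h₁.exists_edist (Sum.inr p) (Sum.inr q)
  rw [h] at ha
  have : n = a := by exact_mod_cast ha
  rcases p with ⟨_ | _, t⟩ <;> rcases q with ⟨_ | _, t'⟩ <;> simp only [pos] at ha' <;> omega

/-- In the situation of `edist_ne_of_overlap`, the three brooms together have at least `4 * s`
leaves: the leaves at one end of the third broom are not leaves of the other two. -/
lemma four_mul_le_card_of_common [Finite X] (h₁ : IsBroomMap G f₁) (h₂ : IsBroomMap G f₂)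
    (h₃ : IsBroomMap G f₃) (h12 : d₁ + 2 < d₂ ∨ d₂ + 2 < d₁)
    (h13 : d₁ + 6 < d₃ ∨ d₃ + 6 < d₁) (h23 : d₂ + 6 < d₃ ∨ d₃ + 6 < d₂) (h1 : 0 < d₁) (h3 : 2 < d₃)
    (hd₁ : d₁ + 8 < d₂ + d₃) (hd₂ : d₂ + 8 < d₁ + d₃) {t₁ t₂ : Fin s}
    (h0 : f₁ (Sum.inr (false, t₁)) = f₂ (Sum.inr (false, t₂)))
    {x : BroomV s d₁} {y : BroomV s d₂} (hxy : f₁ x = f₂ y) (hx : min d₁ d₂ ≤ pos x) :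
    4 * s ≤ Nat.card X := by
  obtain ⟨e, he⟩ : ∃ e : Bool, ∀ t p, f₃ (Sum.inr (e, t)) ≠ f₁ (Sum.inr p) ∧
      f₃ (Sum.inr (e, t)) ≠ f₂ (Sum.inr p) := by
    by_contra! hcon
    have hleaf : ∀ e, ∃ t p, f₃ (Sum.inr (e, t)) = f₁ (Sum.inr p) ∨
        f₃ (Sum.inr (e, t)) = f₂ (Sum.inr p) := by
      intro e
      obtain ⟨t, p, h⟩ := hcon e
      exact ⟨t, p, or_iff_not_imp_left.2 h⟩
    obtain ⟨t, p, hp⟩ := hleaf false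
    obtain ⟨t', q, hq⟩ := hleaf true
    obtain ⟨n, hn, hnr, hn'⟩ := h₃.exists_edist (Sum.inr (false, t)) (Sum.inr (true, t'))
    simp only [pos] at hn'
    have l1 : d₃ + 2 ≤ n := by omega
    have l2 : n ≤ d₃ + 4 := by omega
    rcases hp with hp | hp <;> rcases hq with hq | hq <;> rw [hp, hq] at hn hnr
    · exact edist_leaf_ne h₁ h13 h3 p q l1 l2 hn
    · exact edist_ne_of_overlap h₁ h₂ h13 h23 hd₁ hd₂ h0 hxy hx p q l1 l2 hn
    · exact edist_ne_of_overlap h₁ h₂ h13 h23 hd₁ hd₂ h0 hxy hx q p l1 l2 hnr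
    · exact edist_leaf_ne h₂ h23 h3 p q l1 l2 hn
  have i₁ := injective_of_edist h₁
  have i₂ := injective_of_edist h₂
  have i₃ := injective_of_edist h₃
  let g : Fin s ⊕ (Fin s ⊕ Bool × Fin s) → X :=
    Sum.elim (fun t => f₃ (Sum.inr (e, t)))
      (Sum.elim (fun t => f₁ (Sum.inr (true, t))) (fun p => f₂ (Sum.inr p)))
  have hg : Function.Injective g := by
    refine Function.Injective.sumElim (fun t t' h => ?_)
      (Function.Injective.sumElim (fun t t' h => ?_) (fun t t' h => ?_) ?_) ?_
    · simpa using i₃ h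
    · simpa using i₁ h
    · simpa using i₂ h
    · exact fun t p => leaf_ne_of_common_leaf h₁ h₂ h12 h1 h0 t p
    · rintro t (t' | p)
      · exact (he t _).1
      · exact (he t _).2
  have hc := Nat.card_le_card_of_injective g hg
  simp [Nat.card_eq_fintype_card] at hc
  omega

/-- Two double brooms with a large overlap share a leaf: their paths are too short to account for
the overlap. -/
lemma exists_common_leaf [Finite X] (hs : max d₁ d₂ + 1 < s)
    (hU : s + 1 + min d₁ d₂ ≤ (Set.range f₁ ∩ Set.range f₂).ncard) :
    ∃ p q : Bool × Fin s, f₁ (Sum.inr p) = f₂ (Sum.inr q) := by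
  by_contra! hcon
  have hsub : Set.range f₁ ∩ Set.range f₂ ⊆
      Set.range (fun i => f₁ (Sum.inl i)) ∪ Set.range (fun i => f₂ (Sum.inl i)) := by
    rintro z ⟨⟨i | p, rfl⟩, ⟨j | q, h⟩⟩
    · exact Or.inl ⟨i, rfl⟩
    · exact Or.inl ⟨i, rfl⟩
    · exact Or.inr ⟨j, h⟩
    · exact absurd h.symm (hcon p q)
  have hr : ∀ {n : ℕ} (g : Fin n → X), (Set.range g).ncard ≤ n := by
    intro n g
    rw [← Set.image_univ]
    refine (Set.ncard_image_le Set.finite_univ).trans ?_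
    simp [Set.ncard_univ]
  have hc := (Set.ncard_le_ncard hsub (Set.toFinite _)).trans (Set.ncard_union_le _ _)
  have := hr (fun i => f₁ (Sum.inl i))
  have := hr (fun i => f₂ (Sum.inl i))
  omega

/-- Two double brooms with a large overlap share a vertex that is far from the first end of the
first broom, by counting the vertices near that end. -/
lemma exists_common_far [Finite X]
    (hU : s + 1 + min d₁ d₂ ≤ (Set.range f₁ ∩ Set.range f₂).ncard) :
    ∃ x y, f₁ x = f₂ y ∧ min d₁ d₂ ≤ pos x := by
  by_contra! hcon
  let g : Fin (min d₁ d₂) ⊕ Fin s → X :=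
    Sum.elim (fun i => f₁ (Sum.inl ⟨i, by omega⟩)) (fun t => f₁ (Sum.inr (false, t)))
  have hsub : Set.range f₁ ∩ Set.range f₂ ⊆ Set.range g := by
    rintro z ⟨⟨x, rfl⟩, ⟨y, h⟩⟩
    have hx := hcon x y h.symm
    rcases x with i | ⟨_ | _, t⟩ <;> simp only [pos] at hx
    · exact ⟨Sum.inl ⟨i, by omega⟩, rfl⟩
    · exact ⟨Sum.inr t, rfl⟩
    · omega
  have hc := Set.ncard_le_ncard hsub (Set.toFinite _)
  have hr : (Set.range g).ncard ≤ min d₁ d₂ + s := by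
    rw [← Set.image_univ]
    refine (Set.ncard_image_le Set.finite_univ).trans ?_
    simp [Set.ncard_univ]
  omega

/-- If two double brooms overlap as much as possible inside a graph which also contains a third
one, then that graph has at least `4 * s` vertices. -/
lemma four_mul_le_card [Finite X] (h₁ : IsBroomMap G f₁) (h₂ : IsBroomMap G f₂)
    (h₃ : IsBroomMap G f₃) (h12 : d₁ + 2 < d₂ ∨ d₂ + 2 < d₁)
    (h13 : d₁ + 6 < d₃ ∨ d₃ + 6 < d₁) (h23 : d₂ + 6 < d₃ ∨ d₃ + 6 < d₂) (h1 : 0 < d₁) (h3 : 2 < d₃)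
    (hd₁ : d₁ + 8 < d₂ + d₃) (hd₂ : d₂ + 8 < d₁ + d₃) (hs : max d₁ d₂ + 1 < s)
    (hU : (Set.range f₁ ∪ Set.range f₂).ncard ≤ 3 * s + 1 + max d₁ d₂) :
    4 * s ≤ Nat.card X := by
  have hr : ∀ {d : ℕ} {f : BroomV s d → X}, IsBroomMap G f →
      (Set.range f).ncard = d + 1 + 2 * s := by
    intro d f hf
    rw [← Set.image_univ, Set.ncard_image_of_injective _ (injective_of_edist hf), Set.ncard_univ]
    exact broomGraph_order s d
  have hI : s + 1 + min d₁ d₂ ≤ (Set.range f₁ ∩ Set.range f₂).ncard := by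
    have := Set.ncard_union_add_ncard_inter (Set.range f₁) (Set.range f₂)
    rw [hr h₁, hr h₂] at this
    omega
  obtain ⟨⟨b₁, t₁⟩, ⟨b₂, t₂⟩, h0⟩ := exists_common_leaf hs hI
  -- Exchanging the ends of the brooms where necessary, the common leaf is at both first ends.
  obtain ⟨g₁, hg₁, hgr₁, hgt₁⟩ : ∃ g, IsBroomMap G g ∧ Set.range g = Set.range f₁ ∧
      g (Sum.inr (false, t₁)) = f₁ (Sum.inr (b₁, t₁)) := by
    cases b₁
    · exact ⟨f₁, h₁, rfl, rfl⟩
    · exact ⟨f₁ ∘ flip, h₁.flip, flip.surjective.range_comp f₁, rfl⟩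
  obtain ⟨g₂, hg₂, hgr₂, hgt₂⟩ : ∃ g, IsBroomMap G g ∧ Set.range g = Set.range f₂ ∧
      g (Sum.inr (false, t₂)) = f₂ (Sum.inr (b₂, t₂)) := by
    cases b₂
    · exact ⟨f₂, h₂, rfl, rfl⟩
    · exact ⟨f₂ ∘ flip, h₂.flip, flip.surjective.range_comp f₂, rfl⟩
  rw [← hgt₁, ← hgt₂] at h0
  rw [← hgr₁, ← hgr₂] at hI
  obtain ⟨x, y, hxy, hx⟩ := exists_common_far hI
  exact four_mul_le_card_of_common hg₁ hg₂ h₃ h12 h13 h23 h1 h3 hd₁ hd₂ h0 hxy hx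

end Overlap

/-! ### The greedy strategy -/

/-- Two double brooms have an isometric-universal graph whose order exceeds that of the larger one
by only `s`: attach `s` further leaves to its path. -/
lemma exists_pair_universal (s d₁ d₂ : ℕ) : ∃ W : FinGraph,
    IsIsometricUniversal ![broomGraph s d₁, broomGraph s d₂] W ∧
      W.order = 3 * s + 1 + max d₁ d₂ := by
  simp only [isIsometricUniversal_iff, Fin.forall_fin_two]
  rcases le_total d₁ d₂ with h | h
  · refine ⟨spiderGraph s ![d₁, d₂ - d₁, 0], ⟨?_, ?_⟩, ?_⟩
    · exact isoEmbeds_spider s _ (j := 0) (k := 2) (by decide) (by simp)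
    · exact isoEmbeds_spider s _ (j := 0) (k := 1) (by decide) (by simp; omega)
    · rw [spiderGraph_order]; simp; omega
  · refine ⟨spiderGraph s ![d₂, d₁ - d₂, 0], ⟨?_, ?_⟩, ?_⟩
    · exact isoEmbeds_spider s _ (j := 0) (k := 1) (by decide) (by simp; omega)
    · exact isoEmbeds_spider s _ (j := 0) (k := 2) (by decide) (by simp)
    · rw [spiderGraph_order]; simp; omega

/-- The lengths of the paths of the three double brooms of the family. -/
def pathLength : Fin 3 → ℕ := ![30, 40, 50]

/-- Three double brooms, with `100` leaves at each end. -/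
def brooms (i : Fin (2 + 1)) : FinGraph := broomGraph 100 (pathLength i)

lemma isTreeFamily_brooms : IsTreeFamily brooms := by
  refine ⟨fun i => broom_isTree _ _, fun i j hij => ?_⟩
  rintro ⟨e⟩
  have h : (brooms i).order = (brooms j).order := Nat.card_congr e.toEquiv
  simp only [brooms, broomGraph_order] at h
  apply hij
  fin_cases i <;> fin_cases j <;> simp_all [pathLength]

/-- A spider with legs of lengths `10`, `20`, `30` contains all three brooms. -/
lemma isIsometricUniversal_spider :
    IsIsometricUniversal brooms (spiderGraph 100 ![10, 20, 30]) := by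
  refine isIsometricUniversal_iff.2 fun i => ?_
  fin_cases i
  · exact isoEmbeds_spider 100 _ (j := 0) (k := 1) (by decide) rfl
  · exact isoEmbeds_spider 100 _ (j := 0) (k := 2) (by decide) rfl
  · exact isoEmbeds_spider 100 _ (j := 1) (k := 2) (by decide) rfl

/-- The greedy strategy needs `400` vertices, whatever the order: its first step must overlap two of
the brooms as much as possible, and the result contains that overlap isometrically. -/
lemma le_order_greedyResult {A : FinGraph → FinGraph → FinGraph}
    (hA : IsMinimumMinimalPairOracle A) (σ : Equiv.Perm (Fin (2 + 1))) :
    400 ≤ (greedyResult A (brooms ∘ σ)).order := by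
  have hres : greedyResult A (brooms ∘ σ) =
      A (A (brooms (σ 0)) (brooms (σ 1))) (brooms (σ 2)) := rfl
  rw [hres]
  obtain ⟨⟨huniv₁, hmin⟩, -⟩ := hA (brooms (σ 0)) (brooms (σ 1))
  obtain ⟨⟨huniv₂, -⟩, -⟩ := hA (A (brooms (σ 0)) (brooms (σ 1))) (brooms (σ 2))
  obtain ⟨W, hW, hWo⟩ := exists_pair_universal 100 (pathLength (σ 0)) (pathLength (σ 1))
  have hle := (hmin W hW).trans_eq hWo
  generalize A (A (brooms (σ 0)) (brooms (σ 1))) (brooms (σ 2)) = U₂ at *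
  generalize A (brooms (σ 0)) (brooms (σ 1)) = U₁ at *
  obtain ⟨g, hg⟩ : IsoEmbeds U₁ U₂ := isIsometricUniversal_iff.1 huniv₂ 0
  obtain ⟨f₃, hf₃⟩ : IsoEmbeds (brooms (σ 2)) U₂ := isIsometricUniversal_iff.1 huniv₂ 1
  obtain ⟨f₁, hf₁⟩ : IsoEmbeds (brooms (σ 0)) U₁ := isIsometricUniversal_iff.1 huniv₁ 0
  obtain ⟨f₂, hf₂⟩ : IsoEmbeds (brooms (σ 1)) U₁ := isIsometricUniversal_iff.1 huniv₁ 1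
  have hf₁' : IsBroomMap U₂.graph (g ∘ f₁) := fun u v => (hg _ _).trans (hf₁ u v)
  have hf₂' : IsBroomMap U₂.graph (g ∘ f₂) := fun u v => (hg _ _).trans (hf₂ u v)
  have hU : (Set.range (g ∘ f₁) ∪ Set.range (g ∘ f₂)).ncard ≤
      3 * 100 + 1 + max (pathLength (σ 0)) (pathLength (σ 1)) := by
    refine le_trans ?_ hle
    rw [Set.range_comp, Set.range_comp, ← Set.image_union]
    refine (Set.ncard_image_le (Set.toFinite _)).trans ?_
    exact (Set.ncard_le_ncard (Set.subset_univ _) (Set.toFinite _)).trans_eq (Set.ncard_univ _)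
  have hlen : ∀ i j k : Fin 3, i ≠ j → i ≠ k → j ≠ k →
      (pathLength i + 6 < pathLength j ∨ pathLength j + 6 < pathLength i) ∧
      pathLength i + 8 < pathLength j + pathLength k ∧ max (pathLength i) (pathLength j) + 1 < 100 ∧
      2 < pathLength i := by
    decide
  have h01 : σ 0 ≠ σ 1 := σ.injective.ne (by decide)
  have h02 : σ 0 ≠ σ 2 := σ.injective.ne (by decide)
  have h12 : σ 1 ≠ σ 2 := σ.injective.ne (by decide)
  obtain ⟨a1, a2, a3, a4⟩ := hlen _ _ _ h01 h02 h12
  obtain ⟨b1, b2, b3, b4⟩ := hlen _ _ _ h12 h01.symm h02.symm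
  obtain ⟨c1, c2, c3, c4⟩ := hlen _ _ _ h02.symm h12.symm h01
  exact four_mul_le_card (f₃ := f₃) hf₁' hf₂' hf₃ (by omega) (by omega) (by omega)
    (by omega) (by omega) (by omega) (by omega) a3 hU

end IsoUniv

theorem mainTheorem8 (A : IsoUniv.FinGraph → IsoUniv.FinGraph → IsoUniv.FinGraph)
    (hA : IsoUniv.IsMinimumMinimalPairOracle A) :
    (∃ (m : ℕ) (F : Fin (m + 1) → IsoUniv.FinGraph), IsoUniv.IsTreeFamily F ∧
      ∀ σ : Equiv.Perm (Fin (m + 1)),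
        ¬ IsoUniv.IsMinimumIsometricUniversal F (IsoUniv.greedyResult A (F ∘ σ))) ∧
    (∃ (m : ℕ) (F : Fin (m + 1) → IsoUniv.FinGraph), IsoUniv.IsTreeFamily F ∧
      ∀ σ : Equiv.Perm (Fin (m + 1)),
        ¬ IsoUniv.IsMinimumIsometricUniversalTree F (IsoUniv.greedyResult A (F ∘ σ))) := by
  have hW : (IsoUniv.spiderGraph 100 ![10, 20, 30]).order = 361 :=
    IsoUniv.spiderGraph_order _ _
  refine ⟨⟨2, IsoUniv.brooms, IsoUniv.isTreeFamily_brooms, fun σ h => ?_⟩,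
    ⟨2, IsoUniv.brooms, IsoUniv.isTreeFamily_brooms, fun σ h => ?_⟩⟩
  · have h1 := h.2 _ IsoUniv.isIsometricUniversal_spider
    have h2 := IsoUniv.le_order_greedyResult hA σ
    omega
  · have h1 := h.2.2 (IsoUniv.spiderGraph 100 ![10, 20, 30]) (IsoUniv.spider_isTree _ _)
       IsoUniv.isIsometricUniversal_spider
    have h2 := IsoUniv.le_order_greedyResult hA σ
    omega
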